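/- Let $\mathcal E_1,\dots,\mathcal E_n$ be independent symmetric exponential random variables with variance $1$, i.e. each $\mathcal E_i$ has density $2^{-1/2}\exp(-\sqrt2\,|x|)$ on $\mathbb R$, and let $a=(a_1,\dots,a_n)\in\mathbb R^n$. Then for every real $p\ge 2$, \[ \max\Big\{\gamma_p\|a\|_2,\ \frac{p}{e\sqrt2}\|a\|_\infty\Big\}\ \le\ \Big\|\sum_{i=1}^n a_i\mathcal E_i\Big\|_p\ \le\ \gamma_p\|a\|_2+p\|a\|_\infty, \] where $\|X\|_p=(\mathbf E|X|^p)^{1/p}$ for a random variable $X$, $\|a\|_2=(\sum_{i=1}^n a_i^2)^{1/2}$, $\|a\|_\infty=\max_{i}|a_i|$, and $\gamma_p=(\mathbf E|g|^p)^{1/p}$ is the $p$-th norm of a standard Gaussian variable $g\sim N(0,1)$, i.e. $\gamma_p^p=2^{p/2}\Gamma(\frac{p+1}{2})/\sqrt\pi$. -/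

import Mathlib

open MeasureTheory ProbabilityTheory
open scoped ENNReal

/-- The symmetric exponential law with variance `1`: the measure on `ℝ` with density
`x ↦ 2 ^ (-1/2) * exp (-√2 |x|)` with respect to Lebesgue measure. -/
noncomputable def symmExpMeasure : Measure ℝ :=
  volume.withDensity fun x => ENNReal.ofReal ((√2)⁻¹ * Real.exp (-√2 * |x|))

/-- `γ_p = ‖N(0,1)‖_p`, the `L^p` norm of a standard Gaussian variable. -/
noncomputable def gaussianNorm (p : ℝ) : ℝ :=
  (∫ x, |x| ^ p ∂gaussianReal 0 1) ^ (1 / p)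

/-! The law `symmExpMeasure` is a Gaussian mixture: if `Y` is standard exponential and `g` an
independent standard Gaussian, then `√Y * g` has characteristic function `E exp (-u² Y / 2) = 1 / (1
+ u² / 2)`. Hence `∑ aᵢ ℰᵢ` has the law of `√(∑ aᵢ² Yᵢ) * g`, and its `p`-norm is `γ_p` times the
square root of the `p/2`-norm of `∑ aᵢ² Yᵢ` (`eLpNorm_sum_eq`). Everything reduces to moments of a
nonnegative sum.

Jensen and `E Yᵢ = 1` give the lower bound `γ_p ‖a‖₂`. For the other lower bound, the moments
increase with each `aᵢ²`, so all coordinates but a largest one may be dropped; Markov's inequality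
then handles a single variable.

For the upper bound, an exponential-moment estimate gives `‖∑ bᵢ Yᵢ‖_q ≤ ∑ bᵢ + q max bᵢ`. With `bᵢ
= aᵢ²` and `q = p / 2` the norm is at most `γ_p √(‖a‖₂² + p ‖a‖∞² / 2)`, and `γ_p² ≤ 2 p` finishes.
-/

theorem expMeasure_one_eq :
    expMeasure 1 = (volume.restrict (Set.Ioi 0)).withDensity
      fun x => ENNReal.ofReal (Real.exp (-x)) := by
  have h : exponentialPDF 1 = (Set.Ici (0 : ℝ)).indicator
      fun x => ENNReal.ofReal (Real.exp (-x)) := by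
    ext x
    rw [exponentialPDF_eq]
    by_cases hx : 0 ≤ x <;> simp [Set.indicator, hx]
  change volume.withDensity (exponentialPDF 1) = _
  rw [h, withDensity_indicator measurableSet_Ici, restrict_Ioi_eq_restrict_Ici]

theorem integral_expMeasure_one {E : Type*} [NormedAddCommGroup E] [NormedSpace ℝ E] (f : ℝ → E) :
    ∫ x, f x ∂expMeasure 1 = ∫ x in Set.Ioi 0, Real.exp (-x) • f x := by
  rw [expMeasure_one_eq, integral_withDensity_eq_integral_toReal_smul (by fun_prop) (by simp)]
  simp [ENNReal.toReal_ofReal (Real.exp_pos _).le]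

theorem integrable_expMeasure_one {E : Type*} [NormedAddCommGroup E] [NormedSpace ℝ E]
    (f : ℝ → E) :
    Integrable f (expMeasure 1) ↔ IntegrableOn (fun x => Real.exp (-x) • f x) (Set.Ioi 0) := by
  rw [expMeasure_one_eq, integrable_withDensity_iff_integrable_smul' (by fun_prop) (by simp)]
  simp [ENNReal.toReal_ofReal (Real.exp_pos _).le, IntegrableOn]

theorem integrable_exp_mul_abs_expMeasure {c : ℝ} (hc : c < 1) :
    Integrable (fun x => Real.exp (c * |x|)) (expMeasure 1) := by
  rw [integrable_expMeasure_one]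
  refine (integrableOn_exp_mul_Ioi (a := c - 1) (by linarith) 0).congr_fun ?_ measurableSet_Ioi
  intro x hx
  simp only [smul_eq_mul, ← Real.exp_add, abs_of_pos (Set.mem_Ioi.1 hx)]
  ring_nf

theorem integral_exp_mul_abs_expMeasure {c : ℝ} (hc : c < 1) :
    ∫ x, Real.exp (c * |x|) ∂expMeasure 1 = (1 - c)⁻¹ := by
  rw [integral_expMeasure_one]
  have : ∫ x in Set.Ioi 0, Real.exp ((c - 1) * x) = (1 - c)⁻¹ := by
    rw [integral_exp_mul_Ioi (by linarith)]
    rw [mul_zero, Real.exp_zero, ← neg_sub 1 c, div_neg, neg_div, neg_neg, one_div]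
  rw [← this]
  refine setIntegral_congr_fun measurableSet_Ioi ?_
  intro x hx
  simp only [smul_eq_mul, ← Real.exp_add, abs_of_pos (Set.mem_Ioi.1 hx)]
  ring_nf

theorem lintegral_abs_expMeasure : ∫⁻ x, ENNReal.ofReal |x| ∂expMeasure 1 = 1 := by
  rw [expMeasure_one_eq, lintegral_withDensity_eq_lintegral_mul _ (by fun_prop) (by fun_prop)]
  have h : ∀ x ∈ Set.Ioi (0 : ℝ), ((fun x => ENNReal.ofReal (Real.exp (-x))) *
      fun x => ENNReal.ofReal |x|) x = ENNReal.ofReal (Real.exp (-x) * x ^ ((2 : ℝ) - 1)) := by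
    intro x hx
    norm_num [← ENNReal.ofReal_mul (Real.exp_pos _).le, abs_of_pos (Set.mem_Ioi.1 hx)]
  rw [setLIntegral_congr_fun measurableSet_Ioi h, ← ofReal_integral_eq_lintegral_ofReal
    (Real.GammaIntegral_convergent two_pos), ← Real.Gamma_eq_integral two_pos, Real.Gamma_two,
    ENNReal.ofReal_one]
  filter_upwards [ae_restrict_mem measurableSet_Ioi] with x hx
  exact mul_nonneg (Real.exp_pos _).le (Real.rpow_nonneg (Set.mem_Ioi.1 hx).le _)

/-! ### Characteristic function and tail of the symmetric exponential law -/

theorem charFun_symmExpMeasure (u : ℝ) :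
    charFun symmExpMeasure u = ((1 + u ^ 2 / 2 : ℝ) : ℂ)⁻¹ := by
  have h2 : (0 : ℝ) < √2 := by positivity
  have hsq : ((√2 : ℝ) : ℂ) ^ 2 = 2 := by
    rw [← Complex.ofReal_pow, Real.sq_sqrt zero_le_two]; norm_num
  rw [charFun_apply_real, symmExpMeasure,
    integral_withDensity_eq_integral_toReal_smul (by fun_prop)
      (Filter.Eventually.of_forall fun _ => ENNReal.ofReal_lt_top)]
  have hre1 : ((u : ℂ) * Complex.I - (√2 : ℝ)).re < 0 := by simp
  have hre2 : 0 < ((u : ℂ) * Complex.I + (√2 : ℝ)).re := by simp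
  have e1 : Set.EqOn (fun x : ℝ => ((√2 : ℝ) : ℂ)⁻¹ * Complex.exp ((u * Complex.I - (√2 : ℝ)) * x))
      (fun x : ℝ => (ENNReal.ofReal ((√2)⁻¹ * Real.exp (-√2 * |x|))).toReal •
        Complex.exp (u * x * Complex.I)) (Set.Ioi 0) := by
    intro x hx
    simp only
    rw [ENNReal.toReal_ofReal (by positivity), abs_of_pos (Set.mem_Ioi.1 hx), Complex.real_smul]
    push_cast
    rw [mul_assoc, ← Complex.exp_add]
    ring_nf
  have e2 : Set.EqOn (fun x : ℝ => ((√2 : ℝ) : ℂ)⁻¹ * Complex.exp ((u * Complex.I + (√2 : ℝ)) * x))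
      (fun x : ℝ => (ENNReal.ofReal ((√2)⁻¹ * Real.exp (-√2 * |x|))).toReal •
        Complex.exp (u * x * Complex.I)) (Set.Iic 0) := by
    intro x hx
    simp only
    rw [ENNReal.toReal_ofReal (by positivity), abs_of_nonpos (Set.mem_Iic.1 hx), Complex.real_smul]
    push_cast
    rw [mul_assoc, ← Complex.exp_add]
    ring_nf
  have i1 := ((integrableOn_exp_mul_complex_Ioi hre1 0).const_mul ((√2 : ℝ) : ℂ)⁻¹)
  have i2 := ((integrableOn_exp_mul_complex_Iic hre2 0).const_mul ((√2 : ℝ) : ℂ)⁻¹)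
  rw [← intervalIntegral.integral_Iic_add_Ioi
    (IntegrableOn.congr_fun i2 e2 measurableSet_Iic)
    (IntegrableOn.congr_fun i1 e1 measurableSet_Ioi),
    ← setIntegral_congr_fun measurableSet_Ioi e1, ← setIntegral_congr_fun measurableSet_Iic e2,
    integral_const_mul, integral_const_mul, integral_exp_mul_complex_Ioi hre1,
    integral_exp_mul_complex_Iic hre2]
  have n1 : (u : ℂ) * Complex.I - (√2 : ℝ) ≠ 0 := fun h => by simp [h] at hre1
  have n2 : (u : ℂ) * Complex.I + (√2 : ℝ) ≠ 0 := fun h => by simp [h] at hre2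
  have n3 : ((1 + u ^ 2 / 2 : ℝ) : ℂ) ≠ 0 := by
    rw [Complex.ofReal_ne_zero]; positivity
  have n4 : ((√2 : ℝ) : ℂ) ≠ 0 := by rw [Complex.ofReal_ne_zero]; positivity
  simp only [Complex.ofReal_zero, mul_zero, Complex.exp_zero]
  rw [← mul_add, inv_mul_eq_div, div_eq_iff n4, eq_comm, inv_mul_eq_div, div_eq_iff n3]
  have : (1 : ℂ) / (u * Complex.I + (√2 : ℝ)) + -1 / (u * Complex.I - (√2 : ℝ))
      = 2 * (√2 : ℝ) / (u ^ 2 + 2) := by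
    have n5 : (u : ℂ) ^ 2 + 2 ≠ 0 := by
      intro h; apply n3; push_cast; linear_combination h / 2
    rw [div_add_div _ _ n2 n1, div_eq_div_iff (mul_ne_zero n2 n1) n5]
    linear_combination (-2 * (√2 : ℝ) * u ^ 2 : ℂ) * Complex.I_sq + 2 * (√2 : ℝ) * hsq
  have n5 : (u : ℂ) ^ 2 + 2 ≠ 0 := by
    intro h; apply n3; push_cast; linear_combination h / 2
  rw [this]
  push_cast
  field_simp
  ring

theorem exp_le_symmExpMeasure_tail {t : ℝ} (ht : 0 ≤ t) :
    ENNReal.ofReal (Real.exp (-√2 * t)) ≤ symmExpMeasure {x | t ≤ |x|} := by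
  have h2 : (0 : ℝ) < √2 := by positivity
  have hset : MeasurableSet {x : ℝ | t ≤ |x|} := measurableSet_le measurable_const (by fun_prop)
  rw [symmExpMeasure, withDensity_apply _ hset]
  have hsub : Set.Iic (-t) ∪ Set.Ioi t ⊆ {x : ℝ | t ≤ |x|} := by
    rintro x (hx | hx)
    · exact (le_neg.1 hx).trans (neg_le_abs x)
    · exact (le_of_lt hx).trans (le_abs_self x)
  refine le_trans ?_ (lintegral_mono_set hsub)
  rw [lintegral_union measurableSet_Ioi
    (Set.disjoint_left.2 fun x hx hx' => by
      simp only [Set.mem_Iic, Set.mem_Ioi] at hx hx'; linarith)]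
  have e1 : ∫⁻ x in Set.Ioi t, ENNReal.ofReal ((√2)⁻¹ * Real.exp (-√2 * |x|))
      = ENNReal.ofReal (Real.exp (-√2 * t) / 2) := by
    rw [setLIntegral_congr_fun (g := fun x => ENNReal.ofReal ((√2)⁻¹ * Real.exp (-√2 * x)))
      measurableSet_Ioi fun x hx => by
        simp only; rw [abs_of_pos (ht.trans_lt (Set.mem_Ioi.1 hx))],
      ← ofReal_integral_eq_lintegral_ofReal
        ((integrableOn_exp_mul_Ioi (by linarith) t).const_mul _)
        (Filter.Eventually.of_forall fun x => by positivity),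
      integral_const_mul, integral_exp_mul_Ioi (by linarith)]
    congr 1
    field_simp
    rw [Real.sq_sqrt zero_le_two]
  have e2 : ∫⁻ x in Set.Iic (-t), ENNReal.ofReal ((√2)⁻¹ * Real.exp (-√2 * |x|))
      = ENNReal.ofReal (Real.exp (-√2 * t) / 2) := by
    rw [setLIntegral_congr_fun (g := fun x => ENNReal.ofReal ((√2)⁻¹ * Real.exp (√2 * x)))
      measurableSet_Iic fun x hx => by
        simp only
        rw [abs_of_nonpos ((Set.mem_Iic.1 hx).trans (neg_nonpos.2 ht)), neg_mul_neg],
      ← ofReal_integral_eq_lintegral_ofReal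
        ((integrableOn_exp_mul_Iic h2 (-t)).const_mul _)
        (Filter.Eventually.of_forall fun x => by positivity),
      integral_const_mul, integral_exp_mul_Iic h2, mul_neg, neg_mul]
    congr 1
    field_simp
    rw [Real.sq_sqrt zero_le_two]
  rw [e1, e2, ← ENNReal.ofReal_add (by positivity) (by positivity), add_halves]

instance isProbabilityMeasure_expMeasure_one : IsProbabilityMeasure (expMeasure 1) :=
  isProbabilityMeasure_expMeasure one_pos

/-! ### Gaussian mixture representation -/

/-- Given the exponentials, the variable is a centred Gaussian of variance `∑ aᵢ² |xᵢ|`; its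
conditional characteristic function factors over `i`. -/
theorem charFun_map_mixture {n : ℕ} (a : Fin n → ℝ) (u : ℝ) :
    charFun (((Measure.pi fun _ : Fin n => expMeasure 1).prod (gaussianReal 0 1)).map
      fun z => √(∑ i, a i ^ 2 * |z.1 i|) * z.2) u
      = ∏ i, ((1 + (a i * u) ^ 2 / 2 : ℝ) : ℂ)⁻¹ := by
  rw [charFun_apply_real, integral_map (by fun_prop) (by fun_prop), integral_prod]
  · have h : ∀ x : Fin n → ℝ, ∫ y, Complex.exp
        (u * ((√(∑ i, a i ^ 2 * |x i|) * y : ℝ) : ℂ) * Complex.I) ∂gaussianReal 0 1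
        = ((∏ i, Real.exp (-(a i * u) ^ 2 / 2 * |x i|) : ℝ) : ℂ) := by
      intro x
      have := charFun_gaussianReal (μ := 0) (v := 1) (u * √(∑ i, a i ^ 2 * |x i|))
      rw [charFun_apply_real] at this
      have hX : 0 ≤ ∑ i, a i ^ 2 * |x i| := Finset.sum_nonneg fun i _ => by positivity
      rw [← Real.exp_sum]
      convert this using 1
      · congr 1; ext y; push_cast; ring_nf
      · rw [Complex.ofReal_exp]
        congr 1
        rw [← Complex.ofReal_pow, mul_pow, Real.sq_sqrt hX, Finset.mul_sum]
        push_cast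
        simp only [mul_zero, zero_mul, zero_sub, one_mul, Finset.sum_div, ← Finset.sum_neg_distrib]
        exact Finset.sum_congr rfl fun i _ => by ring
    simp only [h]
    rw [integral_complex_ofReal,
      integral_fintype_prod_eq_prod (μ := fun _ : Fin n => expMeasure 1)
        (f := fun i (y : ℝ) => Real.exp (-(a i * u) ^ 2 / 2 * |y|)), Complex.ofReal_prod]
    refine Finset.prod_congr rfl fun i _ => ?_
    rw [integral_exp_mul_abs_expMeasure (by nlinarith [sq_nonneg (a i * u)]), Complex.ofReal_inv]
    congr 2
    ring
  · refine Integrable.of_bound (by fun_prop) 1 (Filter.Eventually.of_forall fun z => ?_)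
    rw [← Complex.ofReal_mul, Complex.norm_exp_ofReal_mul_I]

theorem map_sum_eq_map_mixture {Ω : Type*} [MeasurableSpace Ω] {P : Measure Ω}
    [IsProbabilityMeasure P] {n : ℕ} {ℰ : Fin n → Ω → ℝ}
    (hlaw : ∀ i, HasLaw (ℰ i) symmExpMeasure P) (hindep : iIndepFun ℰ P) (a : Fin n → ℝ) :
    P.map (fun ω => ∑ i, a i * ℰ i ω) =
      ((Measure.pi fun _ : Fin n => expMeasure 1).prod (gaussianReal 0 1)).map
      fun z => √(∑ i, a i ^ 2 * |z.1 i|) * z.2 := by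
  have hm : ∀ i, AEMeasurable (ℰ i) P := fun i => (hlaw i).aemeasurable
  have hma : ∀ i, AEMeasurable (fun ω => a i * ℰ i ω) P := fun i => (hm i).const_mul _
  have : IsProbabilityMeasure (P.map fun ω => ∑ i, a i * ℰ i ω) :=
    Measure.isProbabilityMeasure_map (by fun_prop)
  have : IsProbabilityMeasure
      (((Measure.pi fun _ : Fin n => expMeasure 1).prod (gaussianReal 0 1)).map
      fun z => √(∑ i, a i ^ 2 * |z.1 i|) * z.2) :=
    Measure.isProbabilityMeasure_map (by fun_prop)
  refine Measure.ext_of_charFun ?_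
  ext u
  have hi : iIndepFun (fun i ω => a i * ℰ i ω) P :=
    hindep.comp (fun i x => a i * x) fun i => measurable_const_mul _
  rw [charFun_map_mixture, hi.charFun_map_fun_sum_eq_prod hma, Finset.prod_apply]
  refine Finset.prod_congr rfl fun i _ => ?_
  rw [charFun_map_mul_comp (hm i), (hlaw i).map_eq, charFun_symmExpMeasure]

theorem lintegral_enorm_rpow_gaussianReal {p : ℝ} (hp : 1 ≤ p) :
    (∫⁻ y, ‖y‖ₑ ^ p ∂gaussianReal 0 1) ^ (1 / p) = ENNReal.ofReal (gaussianNorm p) := by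
  have hp0 : 0 < p := by linarith
  have hint : Integrable (fun x : ℝ => |x| ^ p) (gaussianReal 0 1) := by
    have := (memLp_id_gaussianReal' (μ := 0) (v := 1) (ENNReal.ofReal p)
      ENNReal.ofReal_ne_top).integrable_norm_rpow (by simpa using hp0) ENNReal.ofReal_ne_top
    simpa [ENNReal.toReal_ofReal hp0.le] using this
  have h0 : ∀ x : ℝ, 0 ≤ |x| ^ p := fun x => by positivity
  rw [gaussianNorm, ← ENNReal.ofReal_rpow_of_nonneg (integral_nonneg h0) (by positivity),
    ofReal_integral_eq_lintegral_ofReal hint (Filter.Eventually.of_forall h0)]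
  congr 1
  refine lintegral_congr fun x => ?_
  rw [← ENNReal.ofReal_rpow_of_nonneg (abs_nonneg x) hp0.le, ← Real.norm_eq_abs, ofReal_norm]

theorem eLpNorm_sum_eq {Ω : Type*} [MeasurableSpace Ω] {P : Measure Ω}
    [IsProbabilityMeasure P] {n : ℕ} {ℰ : Fin n → Ω → ℝ}
    (hlaw : ∀ i, HasLaw (ℰ i) symmExpMeasure P) (hindep : iIndepFun ℰ P) (a : Fin n → ℝ)
    {p : ℝ} (hp : 1 ≤ p) :
    eLpNorm (fun ω => ∑ i, a i * ℰ i ω) (ENNReal.ofReal p) P =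
      (∫⁻ x, ENNReal.ofReal (∑ i, a i ^ 2 * |x i|) ^ (p / 2)
        ∂Measure.pi fun _ : Fin n => expMeasure 1) ^ (1 / p) *
      ENNReal.ofReal (gaussianNorm p) := by
  have hp0 : 0 < p := by linarith
  have hm : ∀ i, AEMeasurable (ℰ i) P := fun i => (hlaw i).aemeasurable
  rw [eLpNorm_eq_lintegral_rpow_enorm_toReal (by simpa using hp0) ENNReal.ofReal_ne_top,
    ENNReal.toReal_ofReal hp0.le,
    ← lintegral_map' (f := fun y : ℝ => ‖y‖ₑ ^ p) (by fun_prop) (by fun_prop),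
    map_sum_eq_map_mixture hlaw hindep, lintegral_map (by fun_prop) (by fun_prop),
    ← lintegral_enorm_rpow_gaussianReal hp, ← ENNReal.mul_rpow_of_nonneg _ _ (by positivity)]
  congr 1
  rw [← lintegral_prod_mul (Measurable.aemeasurable (by fun_prop)) (by fun_prop)]
  refine lintegral_congr fun z => ?_
  have hX : 0 ≤ ∑ i, a i ^ 2 * |z.1 i| := Finset.sum_nonneg fun i _ => by positivity
  rw [enorm_mul, ENNReal.mul_rpow_of_nonneg _ _ hp0.le, Real.enorm_eq_ofReal (Real.sqrt_nonneg _),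
    Real.sqrt_eq_rpow, ← ENNReal.ofReal_rpow_of_nonneg hX (by norm_num), ← ENNReal.rpow_mul]
  congr 2
  ring

/-! ### Moments of weighted sums of exponentials -/

/-- This is `1 + t ≤ exp t` at `t = x / A - 1`, with equality at `x = A`. It trades a moment for an
exponential moment, which factors over independent summands. -/
theorem rpow_le_rpow_mul_exp {x A q : ℝ} (hx : 0 ≤ x) (hA : 0 < A) (hq : 0 ≤ q) :
    x ^ q ≤ A ^ q * Real.exp (q * (x / A - 1)) := by
  have h : x ≤ A * Real.exp (x / A - 1) := by
    have := Real.add_one_le_exp (x / A - 1)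
    rw [sub_add_cancel, div_le_iff₀ hA] at this
    linarith
  calc x ^ q ≤ (A * Real.exp (x / A - 1)) ^ q := Real.rpow_le_rpow hx h hq
    _ = _ := by
      rw [Real.mul_rpow hA.le (Real.exp_pos _).le, ← Real.exp_mul, mul_comm q]

theorem lintegral_rpow_sum_le {n : ℕ} {b : Fin n → ℝ} (hb : ∀ i, 0 ≤ b i) {M q : ℝ}
    (hM : ∀ i, b i ≤ M) (hq : 0 < q) :
    ∫⁻ x, ENNReal.ofReal (∑ i, b i * |x i|) ^ q ∂(Measure.pi fun _ : Fin n => expMeasure 1) ≤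
      ENNReal.ofReal (∑ i, b i + q * M) ^ q := by
  -- If all weights vanish, `M`, and with it `A` below, need not be positive.
  rcases (Finset.sum_nonneg fun i (_ : i ∈ Finset.univ) => hb i).eq_or_lt with hS | hS
  · have hb0 : ∀ i, b i = 0 := fun i =>
      (Finset.sum_eq_zero_iff_of_nonneg fun i _ => hb i).1 hS.symm i (Finset.mem_univ i)
    simp [hb0, ENNReal.zero_rpow_of_pos hq]
  obtain ⟨i₀, -, hi₀⟩ := Finset.exists_ne_zero_of_sum_ne_zero hS.ne'
  have hMpos : 0 < M := ((hb i₀).lt_of_ne' hi₀).trans_le (hM i₀)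
  set S := ∑ i, b i with hSdef
  set A := S + q * M with hA
  have hApos : 0 < A := by positivity
  have hlt : ∀ i, q / A * b i < 1 := fun i => by
    rw [div_mul_eq_mul_div, div_lt_one hApos]
    nlinarith [hM i]
  have hint : Integrable (fun x : Fin n → ℝ => ∏ i, Real.exp (q / A * b i * |x i|))
      (Measure.pi fun _ : Fin n => expMeasure 1) :=
    Integrable.fintype_prod (μ := fun _ : Fin n => expMeasure 1)
      (f := fun i (y : ℝ) => Real.exp (q / A * b i * |y|))
      fun i => integrable_exp_mul_abs_expMeasure (hlt i)
  have hpt : ∀ x : Fin n → ℝ, ENNReal.ofReal (∑ i, b i * |x i|) ^ q ≤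
      ENNReal.ofReal (A ^ q * Real.exp (-q) * ∏ i, Real.exp (q / A * b i * |x i|)) := by
    intro x
    have hX : 0 ≤ ∑ i, b i * |x i| :=
      Finset.sum_nonneg fun i _ => mul_nonneg (hb i) (abs_nonneg _)
    rw [ENNReal.ofReal_rpow_of_nonneg hX hq.le]
    refine ENNReal.ofReal_le_ofReal ((rpow_le_rpow_mul_exp hX hApos hq.le).trans_eq ?_)
    rw [← Real.exp_sum, mul_assoc, ← Real.exp_add]
    congr 2
    simp only [mul_assoc, ← Finset.mul_sum]
    ring
  -- The choice `A = S + q M` gives `A - q bᵢ ≥ S`. The exponents `q bᵢ / S` add up to `q`, which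
  -- cancels the factor `exp (-q)`.
  have hfac : ∀ i, (1 - q / A * b i)⁻¹ ≤ Real.exp (q / S * b i) := by
    intro i
    have h1 : 0 < 1 - q / A * b i := by linarith [hlt i]
    have h2 : S / A ≤ 1 - q / A * b i := by
      rw [div_mul_eq_mul_div, one_sub_div hApos.ne']
      gcongr
      nlinarith [hM i]
    have h3 : (1 - q / A * b i)⁻¹ ≤ q / S * b i + 1 := by
      rw [inv_le_iff_one_le_mul₀ h1]
      have : q / S * b i * (S / A) = q / A * b i := by field_simp
      have h4 : 0 ≤ q / S * b i := mul_nonneg (by positivity) (hb i)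
      nlinarith [mul_le_mul_of_nonneg_left h2 h4]
    exact h3.trans (Real.add_one_le_exp _)
  calc _ ≤ ∫⁻ x, ENNReal.ofReal (A ^ q * Real.exp (-q) * ∏ i, Real.exp (q / A * b i * |x i|))
        ∂(Measure.pi fun _ : Fin n => expMeasure 1) := lintegral_mono hpt
    _ = ENNReal.ofReal (A ^ q * Real.exp (-q) * ∏ i, (1 - q / A * b i)⁻¹) := by
      rw [← ofReal_integral_eq_lintegral_ofReal (hint.const_mul _)
        (Filter.Eventually.of_forall fun x => by positivity), integral_const_mul,
        integral_fintype_prod_eq_prod (μ := fun _ : Fin n => expMeasure 1)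
          (f := fun i (y : ℝ) => Real.exp (q / A * b i * |y|))]
      simp only [integral_exp_mul_abs_expMeasure (hlt _)]
    _ ≤ ENNReal.ofReal (A ^ q) := by
      refine ENNReal.ofReal_le_ofReal ?_
      have : ∏ i, (1 - q / A * b i)⁻¹ ≤ Real.exp q := by
        refine (Finset.prod_le_prod (fun i _ => inv_nonneg.2 (by linarith [hlt i]))
          fun i _ => hfac i).trans_eq ?_
        rw [← Real.exp_sum, ← Finset.mul_sum, div_mul_cancel₀ _ hS.ne']
      calc _ ≤ A ^ q * Real.exp (-q) * Real.exp q := by gcongr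
        _ = A ^ q := by rw [mul_assoc, ← Real.exp_add, neg_add_cancel, Real.exp_zero, mul_one]
    _ = _ := (ENNReal.ofReal_rpow_of_nonneg hApos.le hq.le).symm

theorem le_lintegral_rpow_sum {n : ℕ} {b : Fin n → ℝ} (hb : ∀ i, 0 ≤ b i) {q : ℝ} (hq : 1 ≤ q) :
    ENNReal.ofReal (∑ i, b i) ^ q ≤
      ∫⁻ x, ENNReal.ofReal (∑ i, b i * |x i|) ^ q
        ∂(Measure.pi fun _ : Fin n => expMeasure 1) := by
  have hmean : ∫⁻ x, ENNReal.ofReal (∑ i, b i * |x i|)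
      ∂(Measure.pi fun _ : Fin n => expMeasure 1) = ENNReal.ofReal (∑ i, b i) := by
    have h : ∀ x : Fin n → ℝ, ENNReal.ofReal (∑ i, b i * |x i|) =
        ∑ i, ENNReal.ofReal (b i) * ENNReal.ofReal |x i| := by
      intro x
      rw [ENNReal.ofReal_sum_of_nonneg fun i _ => mul_nonneg (hb i) (abs_nonneg _)]
      exact Finset.sum_congr rfl fun i _ => ENNReal.ofReal_mul (hb i)
    simp only [h]
    rw [lintegral_finsetSum _ fun i _ => by fun_prop, ENNReal.ofReal_sum_of_nonneg fun i _ => hb i]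
    refine Finset.sum_congr rfl fun i _ => ?_
    rw [lintegral_const_mul _ (by fun_prop),
      (measurePreserving_eval (fun _ : Fin n => expMeasure 1) i).lintegral_comp
        (f := fun y : ℝ => ENNReal.ofReal |y|) (by fun_prop),
      lintegral_abs_expMeasure, mul_one]
  have h := eLpNorm'_le_eLpNorm'_of_exponent_le one_pos hq
    (Measure.pi fun _ : Fin n => expMeasure 1)
    (f := fun x => ENNReal.ofReal (∑ i, b i * |x i|)) (Measurable.aestronglyMeasurable (by fun_prop))
  simp only [eLpNorm', enorm_eq_self, ENNReal.rpow_one, div_one, hmean] at h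
  rwa [one_div, ENNReal.le_rpow_inv_iff (by linarith)] at h

/-! ### Growth of Gaussian moments -/

theorem gaussianNorm_nonneg (p : ℝ) : 0 ≤ gaussianNorm p :=
  Real.rpow_nonneg (integral_nonneg fun _ => by positivity) _

theorem integral_exp_sq_div_four_gaussianReal :
    Integrable (fun x : ℝ => Real.exp (x ^ 2 / 4)) (gaussianReal 0 1) ∧
      ∫ x, Real.exp (x ^ 2 / 4) ∂gaussianReal 0 1 = √2 := by
  have h : ∀ x : ℝ, gaussianPDFReal 0 1 x • Real.exp (x ^ 2 / 4) =
      (√(2 * Real.pi))⁻¹ * Real.exp (-(1 / 4) * x ^ 2) := by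
    intro x
    simp only [gaussianPDFReal, smul_eq_mul, NNReal.coe_one, mul_one, sub_zero]
    rw [mul_assoc, ← Real.exp_add]
    ring_nf
  constructor
  · rw [gaussianReal_of_var_ne_zero 0 one_ne_zero, integrable_withDensity_iff_integrable_smul'
      (measurable_gaussianPDF 0 1) (Filter.Eventually.of_forall fun _ => ENNReal.ofReal_lt_top)]
    simp only [gaussianPDF, ENNReal.toReal_ofReal (gaussianPDFReal_nonneg _ _ _), h]
    exact (integrable_exp_neg_mul_sq (by norm_num)).const_mul _
  · rw [integral_gaussianReal_eq_integral_smul one_ne_zero]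
    simp only [h]
    rw [integral_const_mul, integral_gaussian, ← Real.sqrt_inv, ← Real.sqrt_mul (by positivity)]
    congr 1
    field_simp
    norm_num

theorem gaussianNorm_sq_le {p : ℝ} (hp : 2 ≤ p) : gaussianNorm p ^ 2 ≤ 2 * p := by
  have hp0 : 0 < p := by linarith
  obtain ⟨hint, hval⟩ := integral_exp_sq_div_four_gaussianReal
  have hA : 0 < 2 * p := by linarith
  -- With `A = 2 p` the exponent `(p / 2) x² / A` is `x² / 4`, independent of `p`.
  have hpt : ∀ x : ℝ, |x| ^ p ≤ (2 * p) ^ (p / 2) * Real.exp (-(p / 2)) * Real.exp (x ^ 2 / 4) := by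
    intro x
    have h := rpow_le_rpow_mul_exp (sq_nonneg x) hA (half_pos hp0).le
    have e : (x ^ 2) ^ (p / 2) = |x| ^ p := by
      rw [← sq_abs, ← Real.rpow_natCast, ← Real.rpow_mul (abs_nonneg x)]
      congr 1; push_cast; ring
    rw [e] at h
    refine h.trans_eq ?_
    rw [mul_assoc, ← Real.exp_add]
    congr 2
    field_simp
    ring
  have hI : ∫ x, |x| ^ p ∂gaussianReal 0 1 ≤ (2 * p) ^ (p / 2) := by
    calc _ ≤ ∫ x, (2 * p) ^ (p / 2) * Real.exp (-(p / 2)) * Real.exp (x ^ 2 / 4)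
          ∂gaussianReal 0 1 :=
        integral_mono_of_nonneg (Filter.Eventually.of_forall fun x => by positivity)
          (hint.const_mul _) (Filter.Eventually.of_forall hpt)
      _ = (2 * p) ^ (p / 2) * (Real.exp (-(p / 2)) * √2) := by
        rw [integral_const_mul, hval, mul_assoc]
      _ ≤ (2 * p) ^ (p / 2) * 1 := by
        gcongr
        rw [Real.exp_neg, inv_mul_le_iff₀ (Real.exp_pos _), mul_one]
        have h2 : √2 ≤ 2 := by rw [Real.sqrt_le_left zero_le_two]; norm_num
        linarith [Real.add_one_le_exp (p / 2)]
      _ = _ := mul_one _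
  have hg : gaussianNorm p ≤ √(2 * p) := by
    rw [gaussianNorm]
    refine (Real.rpow_le_rpow (integral_nonneg fun _ => by positivity) hI
      (by positivity)).trans_eq ?_
    rw [← Real.rpow_mul hA.le, Real.sqrt_eq_rpow]
    congr 1
    field_simp
  calc gaussianNorm p ^ 2 ≤ √(2 * p) ^ 2 := by gcongr; exact gaussianNorm_nonneg p
    _ = _ := Real.sq_sqrt hA.le

/-- Markov's inequality at level `t = p / √2`, which maximises `t ^ p * exp (-√2 t)`. -/
theorem le_eLpNorm_symmExp {Ω : Type*} [MeasurableSpace Ω] {P : Measure Ω} {X : Ω → ℝ}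
    (hX : HasLaw X symmExpMeasure P) {p : ℝ} (hp : 0 < p) :
    ENNReal.ofReal (p / (Real.exp 1 * √2)) ≤ eLpNorm X (ENNReal.ofReal p) P := by
  have hm := hX.aemeasurable
  have ht : 0 < p / √2 := by positivity
  rw [eLpNorm_eq_lintegral_rpow_enorm_toReal (by simpa using hp) ENNReal.ofReal_ne_top,
    ENNReal.toReal_ofReal hp.le,
    ← lintegral_map' (f := fun y : ℝ => ‖y‖ₑ ^ p) (by fun_prop) hm, hX.map_eq,
    one_div, ENNReal.le_rpow_inv_iff hp]
  refine le_trans ?_ (mul_meas_ge_le_lintegral (by fun_prop) (ENNReal.ofReal (p / √2) ^ p))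
  have hset : {x : ℝ | ENNReal.ofReal (p / √2) ^ p ≤ ‖x‖ₑ ^ p} = {x | p / √2 ≤ |x|} := by
    ext x
    simp only [Set.mem_ofPred_eq]
    rw [ENNReal.rpow_le_rpow_iff hp, ← ofReal_norm, Real.norm_eq_abs,
      ENNReal.ofReal_le_ofReal_iff (abs_nonneg x)]
  rw [hset]
  refine le_trans (le_of_eq ?_) (mul_le_mul_right (exp_le_symmExpMeasure_tail ht.le) _)
  rw [ENNReal.ofReal_rpow_of_nonneg (by positivity) hp.le,
    ENNReal.ofReal_rpow_of_nonneg ht.le hp.le, ← ENNReal.ofReal_mul (by positivity)]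
  congr 1
  have h2 : (0 : ℝ) < √2 := by positivity
  have : p / (Real.exp 1 * √2) = p / √2 * Real.exp (-1) := by
    rw [Real.exp_neg]; field_simp
  rw [this, Real.mul_rpow ht.le (Real.exp_pos _).le, ← Real.exp_mul]
  congr 2
  field_simp

/-! ### The two-sided bound -/

theorem corollary2 {Ω : Type*} [MeasurableSpace Ω] (P : Measure Ω) [IsProbabilityMeasure P]
    (n : ℕ) (ℰ : Fin n → Ω → ℝ)
    (hlaw : ∀ i, HasLaw (ℰ i) symmExpMeasure P)
    (hindep : iIndepFun ℰ P)
    (a : Fin n → ℝ) (p : ℝ) (hp : 2 ≤ p) :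
    ENNReal.ofReal
        (max (gaussianNorm p * ‖WithLp.toLp 2 a‖)
          (p / (Real.exp 1 * √2) * ‖WithLp.toLp ∞ a‖))
      ≤ eLpNorm (fun ω => ∑ i, a i * ℰ i ω) (ENNReal.ofReal p) P ∧
    eLpNorm (fun ω => ∑ i, a i * ℰ i ω) (ENNReal.ofReal p) P
      ≤ ENNReal.ofReal
        (gaussianNorm p * ‖WithLp.toLp 2 a‖ + p * ‖WithLp.toLp ∞ a‖) := by
  have hp0 : 0 < p := by linarith
  have hp1 : 1 ≤ p := by linarith
  have hγ := gaussianNorm_nonneg p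
  have hnorm2 : ‖WithLp.toLp 2 a‖ = √(∑ i, a i ^ 2) := by
    simp [EuclideanSpace.norm_eq]
  have hS : 0 ≤ ∑ i, a i ^ 2 := Finset.sum_nonneg fun i _ => sq_nonneg _
  have hle : ∀ i, |a i| ≤ ‖WithLp.toLp ∞ a‖ := fun i => by
    simpa using PiLp.norm_apply_le (p := ∞) (WithLp.toLp ∞ a) i
  have hroot : ∀ y : ℝ, 0 ≤ y → (ENNReal.ofReal y ^ (p / 2)) ^ (1 / p) = ENNReal.ofReal √y := by
    intro y hy
    rw [← ENNReal.rpow_mul, Real.sqrt_eq_rpow, ← ENNReal.ofReal_rpow_of_nonneg hy (by norm_num)]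
    congr 1
    field_simp
  refine ⟨?_, ?_⟩
  · rw [ENNReal.ofReal_max]
    refine max_le ?_ ?_
    · rw [eLpNorm_sum_eq hlaw hindep a hp1, mul_comm, ENNReal.ofReal_mul (norm_nonneg _), hnorm2,
        ← hroot _ hS]
      gcongr
      exact le_lintegral_rpow_sum (fun i => sq_nonneg (a i)) (by linarith)
    · rcases isEmpty_or_nonempty (Fin n) with hn | hn
      · simp [PiLp.norm_eq_ciSup]
      obtain ⟨j, hj⟩ := exists_eq_ciSup_of_finite (f := fun i => ‖a i‖)
      have hsup : ‖WithLp.toLp ∞ a‖ = |a j| := by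
        rw [PiLp.norm_eq_ciSup, ← Real.norm_eq_abs]
        exact hj.symm
      have hsingle : eLpNorm (fun ω => ∑ i, (Pi.single j (a j) : Fin n → ℝ) i * ℰ i ω) (ENNReal.ofReal p) P =
          ENNReal.ofReal |a j| * eLpNorm (ℰ j) (ENNReal.ofReal p) P := by
        have : (fun ω => ∑ i, (Pi.single j (a j) : Fin n → ℝ) i * ℰ i ω) = a j • ℰ j := by
          ext ω
          rw [Finset.sum_eq_single j (fun i _ hij => by simp [hij]) (by simp)]
          simp
        rw [this, eLpNorm_const_smul, Real.enorm_eq_ofReal_abs]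
      calc _ = ENNReal.ofReal |a j| * ENNReal.ofReal (p / (Real.exp 1 * √2)) := by
            rw [hsup, mul_comm, ENNReal.ofReal_mul (abs_nonneg _)]
        _ ≤ ENNReal.ofReal |a j| * eLpNorm (ℰ j) (ENNReal.ofReal p) P := by
            gcongr
            exact le_eLpNorm_symmExp (hlaw j) hp0
        _ ≤ _ := by
            -- In the mixture form only the squared coefficients enter, so the comparison with one
            -- coordinate is pointwise.
            rw [← hsingle, eLpNorm_sum_eq hlaw hindep _ hp1, eLpNorm_sum_eq hlaw hindep _ hp1]
            have hsq : ∀ i, (Pi.single j (a j) : Fin n → ℝ) i ^ 2 ≤ a i ^ 2 := fun i => by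
              rcases eq_or_ne i j with rfl | hij
              · simp
              · simp [hij, sq_nonneg]
            gcongr ?_ ^ _ * _
            refine lintegral_mono fun x => ?_
            gcongr ?_ ^ _
            exact ENNReal.ofReal_le_ofReal (Finset.sum_le_sum fun i _ =>
              mul_le_mul_of_nonneg_right (hsq i) (abs_nonneg _))
  · set M := ‖WithLp.toLp ∞ a‖ with hM
    have hM0 : 0 ≤ M := norm_nonneg _
    have hub := lintegral_rpow_sum_le (fun i => sq_nonneg (a i)) (M := M ^ 2) (q := p / 2)
      (fun i => sq_le_sq' (abs_le.1 (hle i)).1 (abs_le.1 (hle i)).2) (by linarith)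
    have hB : 0 ≤ ∑ i, a i ^ 2 + p / 2 * M ^ 2 := by positivity
    rw [eLpNorm_sum_eq hlaw hindep a hp1]
    calc _ ≤ (ENNReal.ofReal (∑ i, a i ^ 2 + p / 2 * M ^ 2) ^ (p / 2)) ^ (1 / p) *
          ENNReal.ofReal (gaussianNorm p) := by gcongr
      _ = ENNReal.ofReal (√(∑ i, a i ^ 2 + p / 2 * M ^ 2) * gaussianNorm p) := by
        rw [hroot _ hB, ENNReal.ofReal_mul (Real.sqrt_nonneg _)]
      _ ≤ _ := by
        refine ENNReal.ofReal_le_ofReal ?_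
        rw [hnorm2]
        refine abs_le_of_sq_le_sq' ?_ (by positivity) |>.2
        rw [mul_pow, Real.sq_sqrt hB, add_sq, mul_pow, Real.sq_sqrt hS]
        -- After squaring, `γ_p² p M² / 2 ≤ p² M²` is all that is needed; the cross term on the
        -- right is nonnegative.
        have h1 := mul_le_mul_of_nonneg_right (gaussianNorm_sq_le hp)
          (show 0 ≤ p / 2 * M ^ 2 by positivity)
        have h2 : 0 ≤ 2 * (gaussianNorm p * √(∑ i, a i ^ 2)) * (p * M) := by positivity
        nlinarith
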